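/- Let $\mathbb{K}$ be an algebraically closed field of characteristic $2$, let $v:\mathbb{K}^*\to\mathbb{R}$ be a nontrivial valuation, and let $\mathbb{T}=v(\mathbb{K}^*)\subseteq\mathbb{R}$ be its value group. For $m\ge 0$ let $H_{2,m}\subseteq\mathbb{T}^{m+1}$ be the set of tropical polynomials $f=\bigoplus_{i=0}^m a_ix^i$ with all $a_i\in\mathbb{T}$ that have $0$ as a tropical double root, i.e. for which there are a polynomial $F=\sum_{i=0}^m A_iX^i\in\mathbb{K}[X]$ with $v(A_i)=a_i$ for all $i$ and an element $B\in\mathbb{K}^*$ with $v(B)=0$ and $F(B)=F'(B)=0$. Theorem. (1) For every $m\ge 0$ and every $f=\bigoplus_{i=0}^m a_ix^i$ with $a_i\in\mathbb{T}$: $f\in H_{2,m}$ if and only if the minimum of $\{a_i : 0\le i\le m,\ i \text{ even}\}$ is attained for at least two different even indices and the minimum of $\{a_i : 0\le i\le m,\ i\text{ odd}\}$ is attained for at least two different odd indices. (2) Consequently, for every $n\ge 2$ the closure of $H_{2,2n-1}$ in $\mathbb{R}^{2n}$ is the support of a polyhedral fan (a finite collection of polyhedral convex cones, possibly containing lines,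 that contains the faces of its members and in which any two members meet in a common face). Among the polyhedral fans with this support there is a coarsest one, which every other one refines, and it has exactly $\binom{n}{2}^2$ maximal cones. -/

import Mathlib

/-- The value group of a real valuation `v` of a field, i.e. the set of real numbers `v x`, `x ≠ 0`.
(The value `⊤` is taken at `0` only.) -/
def valueGroup {K : Type*} [Field K] (v : AddValuation K (WithTop ℝ)) : AddSubgroup ℝ where
  carrier := {r | ∃ x : K, v x = (r : WithTop ℝ)}
  zero_mem' := ⟨1, by simp⟩
  add_mem' := by
    rintro a b ⟨x, hx⟩ ⟨y, hy⟩
    exact ⟨x * y, by rw [v.map_mul, hx, hy, WithTop.coe_add]⟩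
  neg_mem' := by
    rintro a ⟨x, hx⟩
    have hx0 : x ≠ 0 := by
      rintro rfl
      simp at hx
    refine ⟨x⁻¹, ?_⟩
    have h : v x + v x⁻¹ = 0 := by rw [← v.map_mul, mul_inv_cancel₀ hx0, v.map_one]
    have hne : v x⁻¹ ≠ ⊤ := (v.ne_top_iff).2 (inv_ne_zero hx0)
    obtain ⟨b, hb⟩ := WithTop.ne_top_iff_exists.1 hne
    rw [hx, ← hb, ← WithTop.coe_add, ← WithTop.coe_zero, WithTop.coe_inj] at h
    rw [← hb, WithTop.coe_inj]
    linarith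

/-- The tropical polynomial `⊕ aᵢ xⁱ`, `0 ≤ i ≤ n`, has `b` as a tropical double root with respect
to `v`: it is the tropicalization of a polynomial `F` over `K` that has a singular point (a common
zero of `F` and of its derivative) of valuation `b`. -/
def IsTropicalDoubleRoot {K : Type*} [Field K] (v : AddValuation K (WithTop ℝ)) {n : ℕ}
    (a : Fin (n + 1) → ℝ) (b : ℝ) : Prop :=
  ∃ F : Polynomial K, F.natDegree ≤ n ∧
    (∀ i : Fin (n + 1), v (F.coeff i) = (a i : WithTop ℝ)) ∧
    ∃ B : K, v B = (b : WithTop ℝ) ∧ F.IsRoot B ∧ (Polynomial.derivative F).IsRoot B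

/-- The set of the tropical polynomials of degree `n`, as coefficient vectors, that have `0` as a
tropical double root. All entries of its members lie in the value group of `v`. -/
def tropicalDoubleRootSpace {K : Type*} [Field K] (v : AddValuation K (WithTop ℝ)) (n : ℕ) :
    Set (Fin (n + 1) → ℝ) :=
  {a | IsTropicalDoubleRoot v a 0}

/-- The minimum of the `a i` with `i` in `s` is attained at two (or more) different indices. -/
def MinAttainedTwice {ι : Type*} (s : Set ι) (a : ι → ℝ) : Prop :=
  ∃ i ∈ s, ∃ j ∈ s, i ≠ j ∧ a i = a j ∧ ∀ k ∈ s, a i ≤ a k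

/-- A polyhedral fan in a real vector space: a finite set of finitely generated convex cones
(which may contain lines), closed under taking faces, any two of which meet in a common face. -/
structure IsPolyhedralFan {E : Type*} [AddCommGroup E] [Module ℝ E]
    (Φ : Set (PointedCone ℝ E)) : Prop where
  finite : Φ.Finite
  fg : ∀ σ ∈ Φ, Submodule.FG σ
  face_mem : ∀ σ ∈ Φ, ∀ τ : PointedCone ℝ E, τ.IsFaceOf σ → τ ∈ Φ
  inf_isFaceOf : ∀ σ ∈ Φ, ∀ τ ∈ Φ, (σ ⊓ τ).IsFaceOf σ ∧ (σ ⊓ τ).IsFaceOf τ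

/-- The support of a set of cones. -/
def fanSupport {E : Type*} [AddCommGroup E] [Module ℝ E] (Φ : Set (PointedCone ℝ E)) : Set E :=
  ⋃ σ ∈ Φ, (σ : Set E)

/-- `Φ` is the coarsest polyhedral fan with support `S`: every polyhedral fan with support `S`
refines it. (Such a fan is unique if it exists.) -/
structure IsCoarsestFan {E : Type*} [AddCommGroup E] [Module ℝ E]
    (Φ : Set (PointedCone ℝ E)) (S : Set E) : Prop where
  isFan : IsPolyhedralFan Φ
  support_eq : fanSupport Φ = S
  coarsest : ∀ Ψ : Set (PointedCone ℝ E), IsPolyhedralFan Ψ → fanSupport Ψ = S →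
    ∀ σ ∈ Ψ, ∃ τ ∈ Φ, σ ≤ τ

/-! ### Sums with prescribed valuations. -/

section Valuation

variable {K : Type*} [Field K] (v : AddValuation K (WithTop ℝ))

/-! In characteristic 2, `X * F'` is the odd part of `F`, so `B ≠ 0` is a double root iff the even
and the odd part both vanish at `B`. These conditions involve disjoint sets of coefficients, and `v
B = 0` leaves the valuations of the terms unchanged. Hence (1) reduces to one question: when can
elements of prescribed valuations sum to zero? Exactly when the minimum is attained twice
(`minAttainedTwice_of_sum_eq_zero`, `exists_sum_eq_zero`).

For (2), the value group is dense, and rounding down is monotone, so it preserves repeated minima;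
the closure is therefore `doubleMinSet` of the parity map. Prescribing at least two minimal indices
in each parity class gives the cones of a fan. It is coarsest because the minimal indices of a point
can be read off from the support near it (`eventually_mem_doubleMinSet_iff`), while any fan's
support looks the same along the relative interior of a cone. Maximal cones prescribe exactly two
indices in each of two classes of size `n`. -/

theorem AddValuation.map_eq_zero_of_sq_add_self_eq_one {w : K} (hw : w ^ 2 + w = 1) :
    v w = 0 ∧ v (1 + w) = 0 := by
  have hmul : v w + v (1 + w) = 0 := by
    rw [← v.map_mul, show w * (1 + w) = 1 by linear_combination hw, v.map_one]
  have h0 : v w = 0 := by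
    rcases lt_trichotomy (v w) 0 with h | h | h
    · have : v (1 + w) = v w := by
        rw [add_comm]
        exact v.map_add_eq_of_lt_left (by rwa [v.map_one])
      rw [this] at hmul
      exact absurd hmul (add_neg_of_neg_of_nonpos h h.le).ne
    · exact h
    · have : v (1 + w) = v 1 := v.map_add_eq_of_lt_left (by rwa [v.map_one])
      rw [this, v.map_one, add_zero] at hmul
      exact hmul
  exact ⟨h0, by rwa [h0, zero_add] at hmul⟩

/-- In a valued algebraically closed field of characteristic two, every element of nonnegative
valuation can be moved by a unit to a unit. -/
theorem AddValuation.exists_unit_add_unit [IsAlgClosed K] [CharP K 2] {t : K} (ht : 0 ≤ v t) :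
    ∃ u : K, v u = 0 ∧ v (t + u) = 0 := by
  rcases ht.eq_or_lt with h | h
  -- For `v t = 0`, `u = 1` can fail by cancellation. A primitive cube root of unity `w` has residue
  -- neither 0 nor 1, so `u = w * t` works.
  · obtain ⟨w, hw⟩ := IsAlgClosed.exists_root
      (Polynomial.X ^ 2 + Polynomial.X + Polynomial.C 1 : Polynomial K) (by
        have : (Polynomial.X ^ 2 + Polynomial.X + Polynomial.C 1 : Polynomial K).degree = 2 := by
          compute_degree!
        rw [this]; decide)
    have h2 : (2 : K) = 0 := CharTwo.two_eq_zero
    have hw' : w ^ 2 + w = 1 := by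
      simp only [Polynomial.IsRoot, Polynomial.eval_add, Polynomial.eval_pow, Polynomial.eval_X,
        Polynomial.eval_C] at hw
      linear_combination hw - h2
    obtain ⟨h3, h4⟩ := v.map_eq_zero_of_sq_add_self_eq_one hw'
    refine ⟨w * t, by rw [v.map_mul, h3, ← h, add_zero], ?_⟩
    rw [show t + w * t = (1 + w) * t by ring, v.map_mul, h4, ← h, add_zero]
  · refine ⟨1, v.map_one, ?_⟩
    rw [add_comm, v.map_add_eq_of_lt_left (by rwa [v.map_one]), v.map_one]

/-- A unique term of least valuation would determine the valuation of the sum and make it finite. -/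
theorem AddValuation.minAttainedTwice_of_sum_eq_zero {ι : Type*} {s : Finset ι} (hs : s.Nonempty)
    {a : ι → ℝ} {c : ι → K} (hc : ∀ i ∈ s, v (c i) = (a i : WithTop ℝ))
    (h0 : ∑ i ∈ s, c i = 0) : MinAttainedTwice (s : Set ι) a := by
  classical
  obtain ⟨i, hi, hmin⟩ := s.exists_min_image a hs
  by_contra hcon
  have hlt : ∀ j ∈ s.erase i, a i < a j := by
    intro j hj
    obtain ⟨hji, hj⟩ := Finset.mem_erase.1 hj
    refine lt_of_le_of_ne (hmin j hj) fun h => hcon ⟨i, hi, j, hj, hji.symm, h, hmin⟩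
  have hsum : v (c i) < v (∑ j ∈ s.erase i, c j) := by
    refine v.map_lt_sum' ?_ fun j hj => ?_
    · rw [hc i hi]; exact WithTop.coe_lt_top _
    · rw [hc i hi, hc j (Finset.mem_of_mem_erase hj)]
      exact WithTop.coe_lt_coe.2 (hlt j hj)
  have := v.map_add_eq_of_lt_left hsum
  rw [Finset.add_sum_erase s c hi, h0, v.map_zero, hc i hi] at this
  exact WithTop.top_ne_coe this

/-- Arbitrary lifts `d k` need correction only at two minimal indices `i`, `j`. If `S` is the sum of
the others, choose a unit `u` with `S / d i + u` a unit; then `u * d i` and `-(S + u * d i)` both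
have valuation `a i`. -/
theorem AddValuation.exists_sum_eq_zero [IsAlgClosed K] [CharP K 2] {ι : Type*} {s : Finset ι}
    {a : ι → ℝ} (ha : ∀ i ∈ s, a i ∈ valueGroup v) (h : MinAttainedTwice (s : Set ι) a) :
    ∃ c : ι → K, (∀ i ∈ s, v (c i) = (a i : WithTop ℝ)) ∧ ∑ i ∈ s, c i = 0 := by
  classical
  obtain ⟨i, hi, j, hj, hij, hval, hmin⟩ := h
  rw [Finset.mem_coe] at hi hj
  have : ∀ k, ∃ x : K, k ∈ s → v x = (a k : WithTop ℝ) := fun k => by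
    by_cases hk : k ∈ s
    · obtain ⟨x, hx⟩ := ha k hk
      exact ⟨x, fun _ => hx⟩
    · exact ⟨0, fun h => absurd h hk⟩
  choose d hd using this
  have hdi0 : d i ≠ 0 := fun h0 => by
    have := hd i hi
    rw [h0, v.map_zero] at this
    exact WithTop.top_ne_coe this
  set S := ∑ k ∈ (s.erase i).erase j, d k with hS
  have hSv : v (d i) ≤ v S := v.map_le_sum fun k hk => by
    have hk : k ∈ s := Finset.mem_of_mem_erase (Finset.mem_of_mem_erase hk)
    rw [hd i hi, hd k hk]
    exact WithTop.coe_le_coe.2 (hmin k hk)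
  have ht : 0 ≤ v (S / d i) := by
    by_contra! hneg
    have h1 : v S = v (S / d i) + v (d i) := by rw [← v.map_mul, div_mul_cancel₀ _ hdi0]
    rw [h1, hd i hi] at hSv
    obtain ⟨b, hb⟩ := WithTop.ne_top_iff_exists.1 (ne_top_of_lt hneg)
    rw [← hb] at hSv hneg
    have h2 : a i ≤ b + a i := by exact_mod_cast hSv
    have h3 : b < 0 := by exact_mod_cast hneg
    linarith
  obtain ⟨u, hu, htu⟩ := v.exists_unit_add_unit ht
  have hjmem : j ∈ s.erase i := Finset.mem_erase.2 ⟨hij.symm, hj⟩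
  refine ⟨fun k => if k = i then -(S + u * d i) else if k = j then u * d i else d k, ?_, ?_⟩
  · intro k hk
    beta_reduce
    by_cases hki : k = i
    · subst hki
      rw [if_pos rfl, v.map_neg, show S + u * d k = (S / d k + u) * d k by field_simp, v.map_mul,
        htu, zero_add, hd k hk]
    · rw [if_neg hki]
      by_cases hkj : k = j
      · rw [if_pos hkj, v.map_mul, hu, zero_add, hd i hi, hval, hkj]
      · rw [if_neg hkj, hd k hk]
  · rw [← Finset.add_sum_erase s _ hi, ← Finset.add_sum_erase _ _ hjmem, if_pos rfl,
      if_neg hij.symm, if_pos rfl, Finset.sum_congr rfl (g := d), ← hS]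
    · ring
    · intro k hk
      obtain ⟨hkj, hk⟩ := Finset.mem_erase.1 hk
      rw [if_neg (Finset.mem_erase.1 hk).1, if_neg hkj]

theorem AddValuation.map_eq_div_of_pow_eq {x y : K} {r : ℝ} {n : ℕ} (hn : n ≠ 0)
    (hx : v x = (r : WithTop ℝ)) (h : y ^ n = x) : v y = ((r / n : ℝ) : WithTop ℝ) := by
  have hy : y ≠ 0 := by
    rintro rfl
    rw [← h, zero_pow hn, v.map_zero] at hx
    exact WithTop.top_ne_coe hx
  obtain ⟨b, hb⟩ := WithTop.ne_top_iff_exists.1 (v.ne_top_iff.2 hy)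
  rw [← h, v.map_pow, ← hb] at hx
  have h1 : n • b = r := by exact_mod_cast hx
  rw [← hb, ← h1, nsmul_eq_mul]
  congr 1
  have : (n : ℝ) ≠ 0 := by exact_mod_cast hn
  field_simp

/-- Extracting `n`-th roots divides a nonzero value by `n`. -/
theorem exists_mem_valueGroup_lt [IsAlgClosed K] (hv : ∃ x : K, x ≠ 0 ∧ v x ≠ 0) {ε : ℝ}
    (hε : 0 < ε) : ∃ δ ∈ valueGroup v, 0 < δ ∧ δ < ε := by
  obtain ⟨x, hx0, hx⟩ := hv
  obtain ⟨b, hb⟩ := WithTop.ne_top_iff_exists.1 (v.ne_top_iff.2 hx0)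
  have hb0 : b ≠ 0 := by
    rintro rfl
    exact hx hb.symm
  have habs : |b| ∈ valueGroup v := by
    have : b ∈ valueGroup v := ⟨x, hb.symm⟩
    rcases abs_choice b with h | h <;> rw [h]
    · exact this
    · exact neg_mem this
  obtain ⟨z, hz⟩ := habs
  obtain ⟨n, hn⟩ := exists_nat_gt (|b| / ε)
  have hn0 : 0 < (n : ℝ) := lt_of_le_of_lt (by positivity) hn
  have hn' : 0 < n := by exact_mod_cast hn0
  obtain ⟨y, hy⟩ := IsAlgClosed.exists_pow_nat_eq z hn'
  refine ⟨|b| / n, ⟨y, v.map_eq_div_of_pow_eq hn'.ne' hz hy⟩, by positivity, ?_⟩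
  rw [div_lt_iff₀ hε] at hn
  rw [div_lt_iff₀ hn0]
  linarith

end Valuation

/-! ### Finitely generated cones and the local structure of fans. -/

section Cones

open Filter Topology

variable {E : Type*} [AddCommGroup E] [Module ℝ E]

theorem PointedCone.mem_hull_finset {s : Finset E} {x : E} :
    x ∈ PointedCone.hull ℝ (s : Set E) ↔
      ∃ f : E → ℝ, (∀ z ∈ s, 0 ≤ f z) ∧ ∑ z ∈ s, f z • z = x := by
  constructor
  · intro h
    obtain ⟨f, -, rfl⟩ := Submodule.mem_span_finset.1 h
    exact ⟨fun z => f z, fun z _ => (f z).2, rfl⟩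
  · rintro ⟨f, hf, rfl⟩
    exact sum_mem fun z hz => PointedCone.smul_mem _ (hf z hz) (Submodule.subset_span hz)

/-- Carathéodory's reduction step for cones. -/
theorem PointedCone.exists_mem_hull_erase [DecidableEq E] {s : Finset E}
    (hs : ¬ LinearIndepOn ℝ id (s : Set E)) {x : E} (hx : x ∈ PointedCone.hull ℝ (s : Set E)) :
    ∃ y ∈ s, x ∈ PointedCone.hull ℝ ((s.erase y : Finset E) : Set E) := by
  obtain ⟨f, hf, rfl⟩ := PointedCone.mem_hull_finset.1 hx
  obtain ⟨g, hg, z₀, hz₀, hgz₀⟩ : ∃ g : E → ℝ, ∑ z ∈ s, g z • z = 0 ∧ ∃ z ∈ s, 0 < g z := by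
    rw [linearIndepOn_finset_iff] at hs
    push Not at hs
    obtain ⟨g, hg, z, hz, hne⟩ := hs
    rcases hne.lt_or_gt with h | h
    · exact ⟨-g, by simpa using hg, z, hz, by simpa using h⟩
    · exact ⟨g, hg, z, hz, h⟩
  -- The least ratio `f / g` is the largest multiple of the relation `g` that can be subtracted from
  -- `f` with all coefficients staying nonnegative; the coefficient at `y` becomes zero.
  obtain ⟨y, hy, hmin⟩ := (s.filter (0 < g ·)).exists_min_image (fun z => f z / g z)
    ⟨z₀, Finset.mem_filter.2 ⟨hz₀, hgz₀⟩⟩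
  obtain ⟨hys, hgy⟩ := Finset.mem_filter.1 hy
  refine ⟨y, hys, PointedCone.mem_hull_finset.2 ⟨fun z => f z - f y / g y * g z, ?_, ?_⟩⟩
  · intro z hz
    have hz := Finset.mem_of_mem_erase hz
    have hq : 0 ≤ f y / g y := div_nonneg (hf y hys) hgy.le
    rcases lt_or_ge 0 (g z) with h | h
    · have := hmin z (Finset.mem_filter.2 ⟨hz, h⟩)
      rw [le_div_iff₀ h] at this
      linarith
    · have := mul_nonpos_of_nonneg_of_nonpos hq h
      linarith [hf z hz]
  · have h0 : (f y - f y / g y * g y) • y = 0 := by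
      rw [div_mul_cancel₀ _ hgy.ne', sub_self, zero_smul]
    rw [← zero_add (∑ z ∈ s.erase y, _), ← h0,
      Finset.add_sum_erase s (fun z => (f z - f y / g y * g z) • z) hys]
    simp only [sub_smul, mul_smul, Finset.sum_sub_distrib, ← Finset.smul_sum, hg, smul_zero,
      sub_zero]

section Topological

variable [TopologicalSpace E] [IsTopologicalAddGroup E] [ContinuousSMul ℝ E] [T2Space E]

/-- The cone is the image of a closed orthant under an injective linear map, which is a closed
embedding. -/
theorem PointedCone.isClosed_hull_of_linearIndepOn {s : Finset E}
    (hs : LinearIndepOn ℝ id (s : Set E)) :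
    IsClosed (PointedCone.hull ℝ (s : Set E) : Set E) := by
  let f : (s → ℝ) →ₗ[ℝ] E := Fintype.linearCombination ℝ (fun z : s => (z : E))
  have hf : LinearMap.ker f = ⊥ := by
    have : LinearIndependent ℝ (fun z : s => (z : E)) := hs
    exact LinearMap.ker_eq_bot.2 this.fintypeLinearCombination_injective
  have heq : (PointedCone.hull ℝ (s : Set E) : Set E) = f '' Set.Ici 0 := by
    ext x
    rw [SetLike.mem_coe, PointedCone.mem_hull_finset]
    constructor
    · rintro ⟨c, hc, rfl⟩
      refine ⟨fun z => c z, fun z => hc z z.2, ?_⟩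
      rw [Fintype.linearCombination_apply, ← Finset.sum_coe_sort s (fun z => c z • z)]
    · classical
      rintro ⟨c, hc, rfl⟩
      refine ⟨fun z => if h : z ∈ s then c ⟨z, h⟩ else 0, fun z hz => ?_, ?_⟩
      · beta_reduce
        rw [dif_pos hz]
        exact hc _
      · rw [Fintype.linearCombination_apply, ← Finset.sum_coe_sort s]
        refine Finset.sum_congr rfl fun z _ => ?_
        beta_reduce
        rw [dif_pos z.2]
  rw [heq]
  exact (LinearMap.isClosedEmbedding_of_injective hf).isClosedMap _ isClosed_Ici

theorem PointedCone.isClosed_hull_finset (s : Finset E) :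
    IsClosed (PointedCone.hull ℝ (s : Set E) : Set E) := by
  classical
  induction s using Finset.strongInduction with
  | H s ih =>
    by_cases hs : LinearIndepOn ℝ id (s : Set E)
    · exact PointedCone.isClosed_hull_of_linearIndepOn hs
    · have : (PointedCone.hull ℝ (s : Set E) : Set E) =
          ⋃ y ∈ s, (PointedCone.hull ℝ ((s.erase y : Finset E) : Set E) : Set E) := by
        ext x
        simp only [Set.mem_iUnion, SetLike.mem_coe, exists_prop]
        refine ⟨PointedCone.exists_mem_hull_erase hs, ?_⟩
        rintro ⟨y, -, hx⟩
        exact Submodule.span_mono (Finset.coe_subset.2 (Finset.erase_subset y s)) hx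
      rw [this]
      exact s.finite_toSet.isClosed_biUnion fun y hy => ih _ (Finset.erase_ssubset hy)

theorem PointedCone.isClosed_of_fg {σ : PointedCone ℝ E} (h : Submodule.FG σ) :
    IsClosed (σ : Set E) := by
  obtain ⟨s, rfl⟩ := h
  exact PointedCone.isClosed_hull_finset s

end Topological

/-- The algebraic relative interior of a convex cone: the points from which a positive multiple of
any other point of the cone can be subtracted. -/
def PointedCone.relInterior (σ : PointedCone ℝ E) : Set E :=
  {x | x ∈ σ ∧ ∀ y ∈ σ, ∃ c : ℝ, 0 < c ∧ x - c • y ∈ σ}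

theorem PointedCone.relInterior_nonempty {σ : PointedCone ℝ E} (h : Submodule.FG σ) :
    σ.relInterior.Nonempty := by
  obtain ⟨s, rfl⟩ := h
  refine ⟨∑ z ∈ s, z, sum_mem fun z hz => Submodule.subset_span hz, fun y hy => ?_⟩
  obtain ⟨f, hf, rfl⟩ := PointedCone.mem_hull_finset.1 hy
  -- The sum of the generators is interior: this factor bounds every `f z`, and the summand 1 keeps
  -- it nonzero.
  have hC : 0 < 1 + ∑ z ∈ s, f z := add_pos_of_pos_of_nonneg one_pos (Finset.sum_nonneg hf)
  refine ⟨(1 + ∑ z ∈ s, f z)⁻¹, inv_pos.2 hC, PointedCone.mem_hull_finset.2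
    ⟨fun z => 1 - (1 + ∑ z ∈ s, f z)⁻¹ * f z, fun z hz => ?_, ?_⟩⟩
  · rw [sub_nonneg, inv_mul_le_iff₀ hC, mul_one]
    linarith [Finset.single_le_sum hf hz]
  · simp only [sub_smul, one_smul, mul_smul, Finset.sum_sub_distrib, ← Finset.smul_sum]

theorem PointedCone.add_mem_relInterior {σ : PointedCone ℝ E} {x y : E} (hx : x ∈ σ.relInterior)
    (hy : y ∈ σ) : x + y ∈ σ.relInterior := by
  refine ⟨add_mem hx.1 hy, fun z hz => ?_⟩
  obtain ⟨c, hc, h⟩ := hx.2 z hz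
  exact ⟨c, hc, by simpa [add_sub_right_comm] using add_mem h hy⟩

/-- For `y ∈ σ`, the point `x` splits in `σ` as `(x - c • y) + c • y`. Since `x` lies in the face `σ
⊓ τ`, so does `y`. -/
theorem IsPolyhedralFan.le_of_mem_relInterior {Φ : Set (PointedCone ℝ E)} (hΦ : IsPolyhedralFan Φ)
    {σ τ : PointedCone ℝ E} (hσ : σ ∈ Φ) (hτ : τ ∈ Φ) {x : E} (hx : x ∈ σ.relInterior)
    (hxτ : x ∈ τ) : σ ≤ τ := by
  intro y hy
  obtain ⟨c, hc, h⟩ := hx.2 y hy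
  have : y ∈ σ ⊓ τ := (hΦ.inf_isFaceOf σ hσ τ hτ).1.mem_of_smul_add_mem hy h hc (by
    rw [add_sub_cancel]
    exact ⟨hx.1, hxτ⟩)
  exact this.2

/-- The support of a fan looks the same near any two points of the relative interior of one of its
cones. -/
theorem IsPolyhedralFan.eventually_add_smul_mem [TopologicalSpace E]
    [IsTopologicalAddGroup E] [ContinuousSMul ℝ E] [T2Space E]
    {Φ : Set (PointedCone ℝ E)} (hΦ : IsPolyhedralFan Φ)
    {σ : PointedCone ℝ E} (hσ : σ ∈ Φ) {x y w : E} (hx : x ∈ σ.relInterior)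
    (hy : y ∈ σ.relInterior) (h : ∀ᶠ ε : ℝ in 𝓝[>] 0, x + ε • w ∈ fanSupport Φ) :
    ∀ᶠ ε : ℝ in 𝓝[>] 0, y + ε • w ∈ fanSupport Φ := by
  -- By finiteness one cone contains `x + ε • w` for arbitrarily small `ε`; being closed it contains
  -- `x`, hence all of `σ`.
  obtain ⟨τ, hτ, hfr⟩ : ∃ τ ∈ Φ, ∃ᶠ ε : ℝ in 𝓝[>] 0, x + ε • w ∈ τ := by
    by_contra! hcon
    have := (eventually_all_finite hΦ.finite).2 hcon
    obtain ⟨ε, h1, h2⟩ := (h.and this).exists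
    simp only [fanSupport, Set.mem_iUnion, exists_prop] at h1
    obtain ⟨τ, hτ, h1⟩ := h1
    exact h2 τ hτ h1
  have hxτ : x ∈ τ := by
    have hcont : Tendsto (fun ε : ℝ => x + ε • w) (𝓝[>] 0) (𝓝 x) := by
      have : Continuous fun ε : ℝ => x + ε • w := by fun_prop
      simpa using (this.tendsto 0).mono_left nhdsWithin_le_nhds
    exact (PointedCone.isClosed_of_fg (hΦ.fg τ hτ)).mem_of_frequently_of_tendsto hfr hcont
  have hστ := hΦ.le_of_mem_relInterior hσ hτ hx hxτ
  obtain ⟨ε, hε, hε0 : 0 < ε⟩ := (hfr.and_eventually self_mem_nhdsWithin).exists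
  obtain ⟨c, hc, hyc⟩ := hy.2 x hx.1
  -- This point is `(y - c • x) + c • (x + ε • w)`; convexity then gives the segment from `y` to it.
  have hend : y + (c * ε) • w ∈ τ := by
    have := add_mem (hστ hyc) (τ.smul_mem hc.le hε)
    convert this using 1
    module
  filter_upwards [Ioo_mem_nhdsGT (mul_pos hc hε0)] with δ hδ
  have hmem : y + δ • w ∈ τ := by
    have h1 : 0 < c * ε := mul_pos hc hε0
    have h2 : 0 ≤ 1 - δ / (c * ε) := by
      rw [sub_nonneg, div_le_one h1]; exact hδ.2.le
    have := add_mem (τ.smul_mem h2 (hστ hy.1)) (τ.smul_mem (div_pos hδ.1 h1).le hend)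
    convert this using 1
    rw [smul_add, smul_smul, div_mul_cancel₀ _ h1.ne', ← add_assoc, ← add_smul]
    simp
  exact Set.mem_biUnion hτ hmem

end Cones

/-! ### The fan of repeated minima. -/

section MinCones

open Filter Topology

variable {ι κ : Type*}

/-- The points of `ι → ℝ` all of whose restrictions to the fibers of `r` attain their minimum at
least twice. -/
def doubleMinSet (r : ι → κ) : Set (ι → ℝ) :=
  {a | ∀ k, MinAttainedTwice {i | r i = k} a}

/-- The cone of the points `a` such that, for each `i` in `I`, `a i` is minimal among the
coordinates in the fiber of `r` through `i`. -/
def minCone (r : ι → κ) (I : Finset ι) : PointedCone ℝ (ι → ℝ) where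
  carrier := {a | ∀ i ∈ I, ∀ j, r j = r i → a i ≤ a j}
  add_mem' := fun ha hb i hi j hj => add_le_add (ha i hi j hj) (hb i hi j hj)
  zero_mem' := fun _ _ _ _ => le_rfl
  smul_mem' := fun c _ ha i hi j hj => mul_le_mul_of_nonneg_left (ha i hi j hj) c.2

/-- `I` contains two different elements of each fiber of `r`. -/
def TwoInEachFiber (r : ι → κ) (I : Finset ι) : Prop :=
  ∀ k, ∃ i ∈ I, ∃ j ∈ I, i ≠ j ∧ r i = k ∧ r j = k

variable {r : ι → κ} {I J : Finset ι} {a b : ι → ℝ}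

theorem mem_minCone : a ∈ minCone r I ↔ ∀ i ∈ I, ∀ j, r j = r i → a i ≤ a j := Iff.rfl

theorem TwoInEachFiber.exists_mem (hI : TwoInEachFiber r I) (k : κ) : ∃ i ∈ I, r i = k := by
  obtain ⟨i, hi, -, -, -, h, -⟩ := hI k
  exact ⟨i, hi, h⟩

theorem TwoInEachFiber.mono (hI : TwoInEachFiber r I) (h : I ⊆ J) : TwoInEachFiber r J := by
  intro k
  obtain ⟨i, hi, j, hj, H⟩ := hI k
  exact ⟨i, h hi, j, h hj, H⟩

theorem minCone_anti (h : I ⊆ J) : minCone r J ≤ minCone r I :=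
  fun _ ha i hi => ha i (h hi)

theorem minCone_inf [DecidableEq ι] : minCone r I ⊓ minCone r J = minCone r (I ∪ J) := by
  refine le_antisymm (fun a ha i hi => ?_)
    (le_inf (minCone_anti Finset.subset_union_left) (minCone_anti Finset.subset_union_right))
  rcases Finset.mem_union.1 hi with h | h
  · exact ha.1 i h
  · exact ha.2 i h

/-- The indicator of the complement of `I` is minimal in its fibers exactly on `I`, since `I` meets
every fiber. -/
theorem minCone_le_minCone_iff (hI : TwoInEachFiber r I) :
    minCone r I ≤ minCone r J ↔ J ⊆ I := by
  classical
  refine ⟨fun h j hj => ?_, minCone_anti⟩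
  by_contra hjI
  obtain ⟨i, hi, hij⟩ := hI.exists_mem (r j)
  have hmem : (fun i => if i ∈ I then (0 : ℝ) else 1) ∈ minCone r I := by
    intro i hi j _
    beta_reduce
    rw [if_pos hi]
    split_ifs <;> norm_num
  have := h hmem j hj i hij
  beta_reduce at this
  rw [if_pos hi, if_neg hjI] at this
  norm_num at this

theorem minCone_injOn : Set.InjOn (minCone r) {I | TwoInEachFiber r I} := fun _ hI _ hJ h =>
  ((minCone_le_minCone_iff hJ).1 h.ge).antisymm ((minCone_le_minCone_iff hI).1 h.le)

theorem minCone_isFaceOf (hI : TwoInEachFiber r I) (h : I ⊆ J) :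
    (minCone r J).IsFaceOf (minCone r I) := by
  refine PointedCone.IsFaceOf.of_mem_of_add_mem_left (minCone_anti h) fun {x y} hx hy hxy => ?_
  intro j hj l hl
  obtain ⟨i, hi, hij⟩ := hI.exists_mem (r j)
  have h1 := hxy j hj i hij
  rw [Pi.add_apply, Pi.add_apply] at h1
  have h2 := hx i hi j hij.symm
  have h3 := hy i hi j hij.symm
  have h4 := hx i hi l (hl.trans hij.symm)
  linarith

theorem twoInEachFiber_iff [DecidableEq κ] :
    TwoInEachFiber r I ↔ ∀ k, 2 ≤ (I.filter (r · = k)).card := by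
  refine forall_congr' fun k => ?_
  refine Iff.trans ⟨?_, ?_⟩ Finset.one_lt_card.symm
  · rintro ⟨i, hi, j, hj, hij, h1, h2⟩
    exact ⟨i, Finset.mem_filter.2 ⟨hi, h1⟩, j, Finset.mem_filter.2 ⟨hj, h2⟩, hij⟩
  · rintro ⟨i, hi, j, hj, hij⟩
    obtain ⟨hi, h1⟩ := Finset.mem_filter.1 hi
    obtain ⟨hj, h2⟩ := Finset.mem_filter.1 hj
    exact ⟨i, hi, j, hj, hij, h1, h2⟩

variable [Fintype ι]

open Classical in
/-- The set of the coordinates of `a` that are minimal in their fiber of `r`. -/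
noncomputable def minIndices (r : ι → κ) (a : ι → ℝ) : Finset ι :=
  {i | ∀ j, r j = r i → a i ≤ a j}

theorem mem_minIndices {i : ι} : i ∈ minIndices r a ↔ ∀ j, r j = r i → a i ≤ a j := by
  simp [minIndices]

theorem mem_minCone_iff_subset : a ∈ minCone r I ↔ I ⊆ minIndices r a :=
  ⟨fun h _ hi => mem_minIndices.2 (h _ hi), fun h _ hi => mem_minIndices.1 (h hi)⟩

theorem mem_minCone_minIndices (r : ι → κ) (a : ι → ℝ) : a ∈ minCone r (minIndices r a) :=
  mem_minCone_iff_subset.2 subset_rfl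

theorem mem_doubleMinSet_iff : a ∈ doubleMinSet r ↔ TwoInEachFiber r (minIndices r a) := by
  refine forall_congr' fun k => ⟨?_, ?_⟩
  · rintro ⟨i, hi, j, hj, hij, h, hmin⟩
    refine ⟨i, mem_minIndices.2 fun l hl => hmin l (hl.trans hi), j,
      mem_minIndices.2 fun l hl => h ▸ hmin l (hl.trans hj), hij, hi, hj⟩
  · rintro ⟨i, hi, j, hj, hij, rfl, hk⟩
    rw [mem_minIndices] at hi hj
    exact ⟨i, rfl, j, hk, hij, (hi j hk).antisymm (hj i hk.symm), hi⟩

theorem lt_of_mem_minCone_of_notMem_minIndices {i j : ι} (ha : a ∈ minCone r I) (hi : i ∈ I)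
    (hij : r j = r i) (hj : j ∉ minIndices r a) : a i < a j := by
  refine lt_of_le_of_ne (ha i hi j hij) fun h => hj (mem_minIndices.2 fun l hl => ?_)
  exact h ▸ ha i hi l (hl.trans hij)

/-- Every face of a cone `minCone r I` is of the same form. -/
theorem exists_eq_minCone_of_isFaceOf {F : PointedCone ℝ (ι → ℝ)}
    (hF : F.IsFaceOf (minCone r I)) : ∃ J, I ⊆ J ∧ F = minCone r J := by
  classical
  let J : Finset ι := {i | ∀ a ∈ F, i ∈ minIndices r a}
  have hJ : ∀ {i}, i ∈ J ↔ ∀ a ∈ F, i ∈ minIndices r a := by simp [J]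
  have hIJ : I ⊆ J := fun i hi => hJ.2 fun a ha => mem_minCone_iff_subset.1 (hF.le ha) hi
  refine ⟨J, hIJ, le_antisymm (fun a ha => mem_minCone_iff_subset.2 fun i hi => hJ.1 hi a ha) ?_⟩
  -- Each index outside `J` is non-minimal at some point of `F`. Summing such witnesses gives one `x
  -- ∈ F` at which all of them are non-minimal in the fibers meeting `I`.
  have : ∀ j, ∃ a ∈ F, j ∉ J → j ∉ minIndices r a := by
    intro j
    by_cases hj : j ∈ J
    · exact ⟨0, F.zero_mem, fun h => absurd hj h⟩
    · have := mt hJ.2 hj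
      push Not at this
      obtain ⟨a, ha, h⟩ := this
      exact ⟨a, ha, fun _ => h⟩
  choose p hpF hp using this
  set x := ∑ j, p j with hx
  have hxF : x ∈ F := sum_mem fun j _ => hpF j
  have hlt : ∀ i ∈ I, ∀ j ∉ J, r j = r i → x i < x j := by
    intro i hi j hj hij
    rw [hx, Finset.sum_apply, Finset.sum_apply]
    refine Finset.sum_lt_sum (fun l _ => hF.le (hpF l) i hi j hij) ⟨j, Finset.mem_univ _, ?_⟩
    exact lt_of_mem_minCone_of_notMem_minIndices (hF.le (hpF j)) hi hij (hp j hj)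
  intro b hb
  -- The strict inequalities of `x` survive a small perturbation, and on `J` the point `b` is
  -- constant in each fiber. The face property applied to `x = c • b + (x - c • b)` then gives `b ∈
  -- F`.
  have hev : ∀ᶠ c : ℝ in 𝓝[>] 0, x - c • b ∈ minCone r I := by
    simp only [mem_minCone, Pi.sub_apply, Pi.smul_apply, smul_eq_mul]
    refine eventually_all.2 fun i => ?_
    by_cases hi : i ∈ I
    swap
    · exact Eventually.of_forall fun c h => absurd h hi
    simp only [hi, true_imp_iff]
    refine eventually_all.2 fun j => ?_
    by_cases hij : r j = r i
    swap
    · exact Eventually.of_forall fun c h => absurd h hij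
    simp only [hij, true_imp_iff]
    by_cases hj : j ∈ J
    · have h1 := (hb i (hIJ hi) j hij).antisymm (hb j hj i hij.symm)
      refine Eventually.of_forall fun c => ?_
      rw [h1]
      exact sub_le_sub_right (hF.le hxF i hi j hij) _
    · have hcont : Tendsto (fun c : ℝ => x j - c * b j - (x i - c * b i)) (𝓝[>] 0)
          (𝓝 (x j - x i)) := by
        have : Continuous fun c : ℝ => x j - c * b j - (x i - c * b i) := by fun_prop
        simpa using (this.tendsto 0).mono_left nhdsWithin_le_nhds
      filter_upwards [hcont.eventually (lt_mem_nhds (sub_pos.2 (hlt i hi j hj hij)))] with c hc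
      linarith
  obtain ⟨c, hc, hc0 : 0 < c⟩ := (hev.and self_mem_nhdsWithin).exists
  refine hF.mem_of_smul_add_mem (minCone_anti hIJ hb) hc hc0 ?_
  rwa [add_sub_cancel]

/-- Subtracting from a point its minimum on each fiber leaves a nonnegative vector supported off
`I`. So the signed fiber indicators and the unit vectors off `I` generate. -/
theorem minCone_fg [Finite κ] (hI : TwoInEachFiber r I) : Submodule.FG (minCone r I) := by
  classical
  cases nonempty_fintype κ
  choose s hsI hs using hI.exists_mem
  let u : κ → ι → ℝ := fun k i => if r i = k then 1 else 0
  let e : ι → ι → ℝ := fun i => Pi.single i 1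
  refine Submodule.fg_def.2 ⟨Set.range u ∪ Set.range (-u) ∪ e '' {i | i ∉ I},
    (((Set.finite_range u).union (Set.finite_range _)).union (Set.toFinite _)),
    le_antisymm (Submodule.span_le.2 ?_) fun a ha => ?_⟩
  · rintro _ ((⟨k, rfl⟩ | ⟨k, rfl⟩) | ⟨l, hl, rfl⟩) i hi j hij
    · simp [u, hij]
    · simp [u, hij]
    · have : i ≠ l := fun h => hl (h ▸ hi)
      simp only [e, Pi.single_apply, if_neg this]
      split_ifs <;> norm_num
  · have hdec : a = ∑ k, a (s k) • u k + ∑ i, (a i - a (s (r i))) • e i := by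
      ext i
      simp [u, e, Pi.single_apply, Finset.sum_apply]
    rw [hdec]
    refine add_mem (sum_mem fun k _ => ?_) (sum_mem fun i _ => ?_)
    · rcases le_total 0 (a (s k)) with h | h
      · exact PointedCone.smul_mem _ h (Submodule.subset_span (Or.inl (Or.inl ⟨k, rfl⟩)))
      · rw [← neg_smul_neg]
        exact PointedCone.smul_mem _ (neg_nonneg.2 h)
          (Submodule.subset_span (Or.inl (Or.inr ⟨k, rfl⟩)))
    · by_cases hi : i ∈ I
      · rw [(ha i hi (s (r i)) (hs _)).antisymm (ha _ (hsI (r i)) i (hs _).symm), sub_self,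
          zero_smul]
        exact zero_mem _
      · exact PointedCone.smul_mem _ (sub_nonneg.2 (ha _ (hsI (r i)) i (hs _).symm))
          (Submodule.subset_span (Or.inr ⟨i, hi, rfl⟩))

/-- The fan of the cones `minCone r I`, where `I` contains two elements of each fiber of `r`. -/
def minFan (r : ι → κ) : Set (PointedCone ℝ (ι → ℝ)) :=
  minCone r '' {I | TwoInEachFiber r I}

theorem isPolyhedralFan_minFan [Finite κ] (r : ι → κ) : IsPolyhedralFan (minFan r) where
  finite := (Set.toFinite _).image _
  fg := by
    rintro _ ⟨I, hI, rfl⟩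
    exact minCone_fg hI
  face_mem := by
    rintro _ ⟨I, hI, rfl⟩ τ hτ
    obtain ⟨J, hIJ, rfl⟩ := exists_eq_minCone_of_isFaceOf hτ
    exact ⟨J, hI.mono hIJ, rfl⟩
  inf_isFaceOf := by
    classical
    rintro _ ⟨I, hI, rfl⟩ _ ⟨J, hJ, rfl⟩
    rw [minCone_inf]
    exact ⟨minCone_isFaceOf hI Finset.subset_union_left,
      minCone_isFaceOf hJ Finset.subset_union_right⟩

theorem fanSupport_minFan (r : ι → κ) : fanSupport (minFan r) = doubleMinSet r := by
  ext a
  simp only [fanSupport, minFan, Set.mem_iUnion, SetLike.mem_coe, exists_prop,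
    Set.exists_mem_image, mem_doubleMinSet_iff]
  refine ⟨?_, fun h => ⟨_, h, mem_minCone_minIndices r a⟩⟩
  rintro ⟨I, hI, ha⟩
  exact hI.mono (mem_minCone_iff_subset.1 ha)

/-- A coordinate of a point of `doubleMinSet r` is minimal in its fiber if and only if the point
leaves `doubleMinSet r` when the coordinate is decreased. -/
theorem eventually_mem_doubleMinSet_iff [DecidableEq ι] (ha : a ∈ doubleMinSet r) (j : ι) :
    (∀ᶠ ε : ℝ in 𝓝[>] 0, a + ε • (-Pi.single j 1 : ι → ℝ) ∈ doubleMinSet r) ↔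
      j ∉ minIndices r a := by
  have hval : ∀ (ε : ℝ) (i : ι), (a + ε • (-Pi.single j 1 : ι → ℝ)) i =
      a i - if i = j then ε else 0 := by
    intro ε i
    simp [Pi.single_apply, sub_eq_add_neg]
  rw [mem_doubleMinSet_iff] at ha
  constructor
  · intro h hj
    obtain ⟨ε, h, hε : 0 < ε⟩ := (h.and self_mem_nhdsWithin).exists
    rw [mem_doubleMinSet_iff] at h
    -- Of two minimal indices in the fiber of `j` after the decrease, one differs from `j`, yet `j`
    -- is now strictly below it.
    obtain ⟨i, hi, hij, hrij⟩ : ∃ i ∈ minIndices r (a + ε • (-Pi.single j 1 : ι → ℝ)),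
        i ≠ j ∧ r j = r i := by
      obtain ⟨i, hi, i', hi', hne, h1, h2⟩ := h (r j)
      by_cases hij : i = j
      · exact ⟨i', hi', fun h => hne (hij.trans h.symm), h2.symm⟩
      · exact ⟨i, hi, hij, h1.symm⟩
    have h1 := mem_minIndices.1 hi j hrij
    rw [hval, hval, if_neg hij, if_pos rfl] at h1
    have h2 := mem_minIndices.1 hj i hrij.symm
    linarith
  · intro hj
    have hev : ∀ᶠ ε : ℝ in 𝓝[>] 0, ∀ i ∈ minIndices r a, r j = r i → ε < a j - a i := by
      refine eventually_all.2 fun i => ?_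
      by_cases hi : i ∈ minIndices r a ∧ r j = r i
      · have := lt_of_mem_minCone_of_notMem_minIndices (mem_minCone_minIndices r a) hi.1 hi.2 hj
        filter_upwards [Ioo_mem_nhdsGT (sub_pos.2 this)] with ε hε _ _
        exact hε.2
      · exact Eventually.of_forall fun ε h1 h2 => absurd ⟨h1, h2⟩ hi
    filter_upwards [hev] with ε hε
    rw [mem_doubleMinSet_iff]
    refine ha.mono fun i hi => mem_minIndices.2 fun l hl => ?_
    have hij : i ≠ j := fun h => hj (h ▸ hi)
    rw [hval, hval, if_neg hij]
    by_cases hlj : l = j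
    · subst hlj
      have := hε i hi hl
      rw [if_pos rfl]
      linarith
    · rw [if_neg hlj]
      linarith [mem_minIndices.1 hi l hl]

theorem isCoarsestFan_minFan [Finite κ] (r : ι → κ) :
    IsCoarsestFan (minFan r) (doubleMinSet r) where
  isFan := isPolyhedralFan_minFan r
  support_eq := fanSupport_minFan r
  coarsest := by
    classical
    intro Ψ hΨ hS σ hσ
    have hmem : ∀ x ∈ σ, x ∈ doubleMinSet r := fun x hx => hS ▸ Set.mem_biUnion hσ hx
    -- By symmetry the minimal indices are constant on the relative interior of `σ`.
    have hsub : ∀ x ∈ σ.relInterior, ∀ y ∈ σ.relInterior, minIndices r x ⊆ minIndices r y := by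
      intro x hx y hy j hj
      by_contra hjy
      have h1 := (eventually_mem_doubleMinSet_iff (hmem y hy.1) j).2 hjy
      rw [← hS] at h1
      have h2 := hΨ.eventually_add_smul_mem hσ hy hx h1
      rw [hS] at h2
      exact (eventually_mem_doubleMinSet_iff (hmem x hx.1) j).1 h2 hj
    obtain ⟨x, hx⟩ := PointedCone.relInterior_nonempty (hΨ.fg σ hσ)
    refine ⟨_, ⟨minIndices r x, mem_doubleMinSet_iff.1 (hmem x hx.1), rfl⟩, ?_⟩
    intro y hy i hi j hij
    by_contra! hlt
    -- For `y` on the boundary, `x + n • y` is still relatively interior, but for this `n` a strict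
    -- inequality `y j < y i` would destroy minimality at `i`.
    obtain ⟨n, hn⟩ := exists_nat_gt ((x j - x i) / (y i - y j))
    rw [div_lt_iff₀ (sub_pos.2 hlt)] at hn
    have h1 := hsub x hx _ (PointedCone.add_mem_relInterior hx (σ.smul_mem n.cast_nonneg hy)) hi
    have h2 := mem_minIndices.1 h1 j hij
    simp only [Pi.add_apply, Pi.smul_apply, smul_eq_mul] at h2
    linarith

theorem isClosed_doubleMinSet (r : ι → κ) : IsClosed (doubleMinSet r) := by
  rw [← fanSupport_minFan]
  refine Set.Finite.isClosed_biUnion ((Set.toFinite _).image _) ?_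
  rintro _ ⟨I, -, rfl⟩
  have : (minCone r I : Set (ι → ℝ)) = ⋂ i ∈ I, ⋂ j, ⋂ _ : r j = r i, {a | a i ≤ a j} := by
    ext a
    simp only [SetLike.mem_coe, mem_minCone, Set.mem_iInter, Set.mem_ofPred_eq]
  rw [this]
  exact isClosed_biInter fun i _ => isClosed_iInter fun j => isClosed_iInter fun _ =>
    isClosed_le (continuous_apply i) (continuous_apply j)

/-- Cones grow as index sets shrink, and any admissible `I` contains one with exactly two elements
per fiber. -/
theorem setOf_maximal_minFan [DecidableEq κ] (r : ι → κ) :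
    {σ | Maximal (fun τ => τ ∈ minFan r) σ} =
      minCone r '' {I | ∀ k, (I.filter (r · = k)).card = 2} := by
  classical
  ext σ
  constructor
  · rintro ⟨⟨I, hI, rfl⟩, hmax⟩
    have hI2 := twoInEachFiber_iff.1 hI
    choose t ht htc using fun k => Finset.exists_subset_card_eq (hI2 k)
    set J : Finset ι := Finset.univ.filter (fun i => i ∈ t (r i)) with hJ
    have hJt : ∀ k, J.filter (r · = k) = t k := by
      intro k
      ext i
      simp only [hJ, Finset.mem_filter, Finset.mem_univ, true_and]
      constructor
      · rintro ⟨h, rfl⟩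
        exact h
      · intro h
        have := (Finset.mem_filter.1 (ht k h)).2
        exact ⟨this ▸ h, this⟩
    have hJ2 : ∀ k, (J.filter (r · = k)).card = 2 := fun k => by rw [hJt, htc]
    have hJI : J ⊆ I := fun i hi =>
      (Finset.mem_filter.1 (ht (r i) (Finset.mem_filter.1 hi).2)).1
    have hJm : TwoInEachFiber r J := twoInEachFiber_iff.2 fun k => (hJ2 k).ge
    exact ⟨J, hJ2, le_antisymm (hmax ⟨J, hJm, rfl⟩ (minCone_anti hJI)) (minCone_anti hJI)⟩
  · rintro ⟨I, hI, rfl⟩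
    have hI2 : TwoInEachFiber r I := twoInEachFiber_iff.2 fun k => (hI k).ge
    refine ⟨⟨I, hI2, rfl⟩, ?_⟩
    rintro _ ⟨J, hJ, rfl⟩ hle
    have hJI := (minCone_le_minCone_iff hI2).1 hle
    refine minCone_anti fun i hi => ?_
    have := Finset.eq_of_subset_of_card_le (Finset.filter_subset_filter (r · = r i) hJI)
      ((hI (r i)).trans_le (twoInEachFiber_iff.1 hJ (r i)))
    have hmem : i ∈ I.filter (r · = r i) := Finset.mem_filter.2 ⟨hi, rfl⟩
    rw [← this] at hmem
    exact (Finset.mem_filter.1 hmem).1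

theorem Finset.card_filter_forall_card_filter_eq [Fintype κ] [DecidableEq ι] [DecidableEq κ]
    (r : ι → κ) (m : ℕ) :
    (Finset.univ.filter fun I : Finset ι => ∀ k, (I.filter (r · = k)).card = m).card =
      ∏ k, (Finset.univ.filter (r · = k)).card.choose m := by
  simp only [← Finset.card_powersetCard]
  rw [← Fintype.card_piFinset]
  refine Finset.card_bij' (fun I _ k => I.filter (r · = k))
    (fun f _ => Finset.univ.filter fun i => i ∈ f (r i)) ?_ ?_ ?_ ?_
  · intro I hI
    simp only [Fintype.mem_piFinset, Finset.mem_powersetCard]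
    exact fun k => ⟨Finset.filter_subset_filter _ (Finset.subset_univ I),
      (Finset.mem_filter.1 hI).2 k⟩
  all_goals
    have key : ∀ f ∈ Fintype.piFinset
        fun k => Finset.powersetCard m (Finset.univ.filter (r · = k)), ∀ k,
        (Finset.univ.filter fun i => i ∈ f (r i)).filter (r · = k) = f k := by
      intro f hf k
      ext i
      simp only [Finset.mem_filter, Finset.mem_univ, true_and]
      constructor
      · rintro ⟨h, rfl⟩
        exact h
      · intro h
        have := (Finset.mem_powersetCard.1 (Fintype.mem_piFinset.1 hf k)).1 h
        have := (Finset.mem_filter.1 this).2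
        exact ⟨this ▸ h, this⟩
  · intro f hf
    refine Finset.mem_filter.2 ⟨Finset.mem_univ _, fun k => ?_⟩
    rw [key f hf k]
    exact (Finset.mem_powersetCard.1 (Fintype.mem_piFinset.1 hf k)).2
  · intro I _
    ext i
    simp
  · intro f hf
    funext k
    exact key f hf k

theorem ncard_setOf_maximal_minFan [Fintype κ] [DecidableEq κ] (r : ι → κ) :
    {σ | Maximal (fun τ => τ ∈ minFan r) σ}.ncard =
      ∏ k, (Finset.univ.filter (r · = k)).card.choose 2 := by
  classical
  rw [setOf_maximal_minFan, Set.InjOn.ncard_image, ← Finset.card_filter_forall_card_filter_eq,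
    ← Set.ncard_coe_finset]
  · simp
  · exact minCone_injOn.mono fun I hI => twoInEachFiber_iff.2 fun k => (hI k).ge

end MinCones

/-! ### Parity classes of indices. -/

theorem MinAttainedTwice.comp_monotone {ι : Type*} {s : Set ι} {a : ι → ℝ}
    (h : MinAttainedTwice s a) {g : ℝ → ℝ} (hg : Monotone g) : MinAttainedTwice s (g ∘ a) := by
  obtain ⟨i, hi, j, hj, hij, h, hmin⟩ := h
  exact ⟨i, hi, j, hj, hij, congrArg g h, fun k hk => hg (hmin k hk)⟩

theorem mem_doubleMinSet_even {n : ℕ} {a : Fin n → ℝ} :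
    a ∈ doubleMinSet (fun i : Fin n => decide (Even (i : ℕ))) ↔
      MinAttainedTwice {i : Fin n | Even (i : ℕ)} a ∧
        MinAttainedTwice {i : Fin n | Odd (i : ℕ)} a := by
  simp [doubleMinSet, and_comm]

theorem card_filter_even_eq (m : ℕ) (b : Bool) :
    (Finset.univ.filter fun i : Fin (2 * m) => decide (Even (i : ℕ)) = b).card = m := by
  have hlt : ∀ k : Fin m, 2 * (k : ℕ) + (if b then 0 else 1) < 2 * m := by
    intro k
    have := k.2
    split_ifs <;> omega
  have : (Finset.univ.filter fun i : Fin (2 * m) => decide (Even (i : ℕ)) = b) =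
      Finset.univ.image fun k : Fin m => (⟨_, hlt k⟩ : Fin (2 * m)) := by
    ext i
    simp only [Finset.mem_filter, Finset.mem_univ, true_and, Finset.mem_image, Fin.ext_iff]
    have hi := i.2
    cases b
    · simp only [decide_eq_false_iff_not, Nat.not_even_iff, Bool.false_eq_true, if_false]
      exact ⟨fun h => ⟨⟨i / 2, by omega⟩, by dsimp only; omega⟩, fun ⟨k, hk⟩ => by omega⟩
    · simp only [decide_eq_true_eq, Nat.even_iff, if_true]
      exact ⟨fun h => ⟨⟨i / 2, by omega⟩, by dsimp only; omega⟩, fun ⟨k, hk⟩ => by omega⟩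
  rw [this, Finset.card_image_of_injective, Finset.card_univ, Fintype.card_fin]
  intro k l h
  have := Fin.ext_iff.1 h
  dsimp only at this
  exact Fin.ext (by omega)

/-! ### Double roots in characteristic two, and the closure. -/

section Char2

variable {K : Type*} [Field K] (v : AddValuation K (WithTop ℝ))

/-- The operator `X * d/dX` multiplies the coefficient of `X ^ i` by `i`, which is 1 or 0 in `K`
according to parity. -/
theorem Polynomial.eval_derivative_mul_self_of_charTwo [CharP K 2] {n : ℕ} {F : Polynomial K}
    (hF : F.natDegree ≤ n) (B : K) :
    (Polynomial.derivative F).eval B * B =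
      ∑ i ∈ Finset.univ.filter (fun i : Fin (n + 1) => Odd (i : ℕ)),
        F.coeff i * B ^ (i : ℕ) := by
  have hF' : F.natDegree < n + 1 := by omega
  conv_lhs => rw [F.as_sum_range' (n + 1) hF']
  rw [Polynomial.derivative_sum, Polynomial.eval_finsetSum, Finset.sum_mul, Finset.sum_range,
    Finset.sum_filter]
  refine Finset.sum_congr rfl fun i _ => ?_
  rw [Polynomial.derivative_monomial, Polynomial.eval_monomial]
  have h2 : (2 : K) = 0 := CharTwo.two_eq_zero
  split_ifs with h
  · obtain ⟨k, hk⟩ := h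
    rw [hk]
    push_cast
    rw [h2, pow_succ]
    ring
  · obtain ⟨k, hk⟩ := Nat.not_odd_iff_even.1 h
    rw [hk]
    push_cast
    rw [CharTwo.add_self_eq_zero (k : K)]
    ring

theorem Polynomial.eval_eq_sum_even_add_sum_odd {n : ℕ} {F : Polynomial K}
    (hF : F.natDegree ≤ n) (B : K) :
    F.eval B = ∑ i ∈ Finset.univ.filter (fun i : Fin (n + 1) => Even (i : ℕ)),
        F.coeff i * B ^ (i : ℕ) +
      ∑ i ∈ Finset.univ.filter (fun i : Fin (n + 1) => Odd (i : ℕ)),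
        F.coeff i * B ^ (i : ℕ) := by
  rw [Polynomial.eval_eq_sum_range' (n := n + 1) (by omega), Finset.sum_range,
    ← Finset.sum_filter_add_sum_filter_not _ (fun i : Fin (n + 1) => Even (i : ℕ))]
  simp only [Nat.not_even_iff_odd]

/-- In characteristic two, `B ≠ 0` is a double root if and only if the even and the odd part both
vanish at `B`. -/
theorem Polynomial.isRoot_and_isRoot_derivative_iff_of_charTwo [CharP K 2] {n : ℕ}
    {F : Polynomial K} (hF : F.natDegree ≤ n) {B : K} (hB : B ≠ 0) :
    F.IsRoot B ∧ (Polynomial.derivative F).IsRoot B ↔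
      ∑ i ∈ Finset.univ.filter (fun i : Fin (n + 1) => Even (i : ℕ)),
        F.coeff i * B ^ (i : ℕ) = 0 ∧
        ∑ i ∈ Finset.univ.filter (fun i : Fin (n + 1) => Odd (i : ℕ)),
        F.coeff i * B ^ (i : ℕ) = 0 := by
  have h1 := Polynomial.eval_derivative_mul_self_of_charTwo hF B
  have h2 := Polynomial.eval_eq_sum_even_add_sum_odd hF B
  simp only [Polynomial.IsRoot]
  constructor
  · rintro ⟨h3, h4⟩
    rw [h4, zero_mul] at h1
    rw [h3, ← h1, add_zero] at h2
    exact ⟨h2.symm, h1.symm⟩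
  · rintro ⟨h3, h4⟩
    rw [h4] at h1 h2
    rw [h3, add_zero] at h2
    exact ⟨h2, (mul_eq_zero.1 h1).resolve_right hB⟩

theorem mem_tropicalDoubleRootSpace_iff [IsAlgClosed K] [CharP K 2] {n : ℕ}
    {a : Fin (n + 1) → ℝ} (ha : ∀ i, a i ∈ valueGroup v) :
    a ∈ tropicalDoubleRootSpace v n ↔
      MinAttainedTwice {i : Fin (n + 1) | Even (i : ℕ)} a ∧
        MinAttainedTwice {i : Fin (n + 1) | Odd (i : ℕ)} a := by
  have hE : {i : Fin (n + 1) | Even (i : ℕ)} =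
      ((Finset.univ.filter fun i : Fin (n + 1) => Even (i : ℕ) : Finset (Fin (n + 1))) :
        Set (Fin (n + 1))) := by simp
  have hO : {i : Fin (n + 1) | Odd (i : ℕ)} =
      ((Finset.univ.filter fun i : Fin (n + 1) => Odd (i : ℕ) : Finset (Fin (n + 1))) :
        Set (Fin (n + 1))) := by simp
  rw [hE, hO]
  constructor
  · rintro ⟨F, hF, hFa, B, hB, hroot⟩
    have hB0 : B ≠ 0 := v.ne_top_iff.1 (by rw [hB]; exact WithTop.coe_ne_top)
    obtain ⟨h1, h2⟩ :=
      (Polynomial.isRoot_and_isRoot_derivative_iff_of_charTwo hF hB0).1 hroot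
    have hval : ∀ i : Fin (n + 1), v (F.coeff i * B ^ (i : ℕ)) = (a i : WithTop ℝ) := by
      intro i
      rw [v.map_mul, v.map_pow, hB, hFa, WithTop.coe_zero, smul_zero, add_zero]
    have h0 : F.coeff 0 ≠ 0 :=
      v.ne_top_iff.1 (by rw [show v (F.coeff 0) = _ from hFa 0]; exact WithTop.coe_ne_top)
    -- There must be an odd index for the odd minimum to exist; a nonzero constant has no root.
    have hn : n ≠ 0 := by
      rintro rfl
      rw [Polynomial.eq_C_of_natDegree_le_zero hF] at hroot
      exact h0 (by simpa using hroot.1)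
    refine ⟨v.minAttainedTwice_of_sum_eq_zero ⟨0, by simp⟩ (fun i _ => hval i) h1,
      v.minAttainedTwice_of_sum_eq_zero ⟨⟨1, by omega⟩, by simp⟩ (fun i _ => hval i) h2⟩
  · rintro ⟨hEa, hOa⟩
    obtain ⟨c, hc, hc0⟩ := v.exists_sum_eq_zero (fun i _ => ha i) hEa
    obtain ⟨d, hd, hd0⟩ := v.exists_sum_eq_zero (fun i _ => ha i) hOa
    classical
    let e : Fin (n + 1) → K := fun i => if Even (i : ℕ) then c i else d i
    let F : Polynomial K := Polynomial.ofFn (n + 1) e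
    have hF : F.natDegree ≤ n :=
      Nat.lt_succ_iff.1 (Polynomial.ofFn_natDegree_lt (Nat.succ_le_succ n.zero_le) e)
    have hFe : ∀ i : Fin (n + 1), F.coeff i = e i := fun i => by
      rw [Polynomial.ofFn_coeff_eq_val_of_lt e i.2]
    -- With `B = 1` both conditions become plain coefficient sums, which the two lifts make zero.
    refine ⟨F, hF, fun i => ?_, 1, v.map_one,
      (Polynomial.isRoot_and_isRoot_derivative_iff_of_charTwo hF one_ne_zero).2 ⟨?_, ?_⟩⟩
    · rw [hFe]
      by_cases h : Even (i : ℕ)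
      · simp only [e, if_pos h]
        exact hc i (by simpa using h)
      · simp only [e, if_neg h]
        exact hd i (by simpa using h)
    · rw [← hc0]
      refine Finset.sum_congr rfl fun i hi => ?_
      rw [hFe, one_pow, mul_one]
      exact if_pos (by simpa using hi)
    · rw [← hd0]
      refine Finset.sum_congr rfl fun i hi => ?_
      rw [hFe, one_pow, mul_one]
      exact if_neg (by simpa using hi)

theorem closure_tropicalDoubleRootSpace [IsAlgClosed K] [CharP K 2]
    (hv : ∃ x : K, x ≠ 0 ∧ v x ≠ 0) (n : ℕ) :
    closure (tropicalDoubleRootSpace v n) =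
      doubleMinSet (fun i : Fin (n + 1) => decide (Even (i : ℕ))) := by
  refine (closure_minimal (fun a ha => ?_) (isClosed_doubleMinSet _)).antisymm fun a ha => ?_
  · have hmem : ∀ i, a i ∈ valueGroup v := by
      obtain ⟨F, -, hF, -⟩ := ha
      exact fun i => ⟨_, hF i⟩
    exact mem_doubleMinSet_even.2 ((mem_tropicalDoubleRootSpace_iff v hmem).1 ha)
  · rw [Metric.mem_closure_iff]
    intro ε hε
    obtain ⟨δ, hδ, hδ0, hδε⟩ := exists_mem_valueGroup_lt v hv hε
    -- Rounding down to multiples of `δ` lands in the value group and moves each coordinate by less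
    -- than `ε`.
    let g : ℝ → ℝ := fun x => ⌊x / δ⌋ • δ
    have hg : Monotone g := fun x y hxy =>
      zsmul_le_zsmul_left hδ0.le (Int.floor_le_floor (div_le_div_of_nonneg_right hxy hδ0.le))
    refine ⟨g ∘ a, ?_, ?_⟩
    · have hmem : ∀ i, (g ∘ a) i ∈ valueGroup v := fun i => zsmul_mem hδ _
      rw [mem_tropicalDoubleRootSpace_iff v hmem]
      obtain ⟨h1, h2⟩ := mem_doubleMinSet_even.1 ha
      exact ⟨h1.comp_monotone hg, h2.comp_monotone hg⟩
    · refine (dist_pi_lt_iff hε).2 fun i => lt_of_le_of_lt ?_ hδε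
      have h1 := Int.floor_le (a i / δ)
      have h2 := Int.lt_floor_add_one (a i / δ)
      rw [le_div_iff₀ hδ0] at h1
      rw [div_lt_iff₀ hδ0] at h2
      rw [Real.dist_eq, abs_le]
      simp only [Function.comp, g, zsmul_eq_mul]
      constructor <;> linarith

end Char2

theorem mainTheorem9 {K : Type*} [Field K] [IsAlgClosed K] [CharP K 2]
    (v : AddValuation K (WithTop ℝ)) (hv : ∃ x : K, x ≠ 0 ∧ v x ≠ 0) :
    (∀ (n : ℕ) (a : Fin (n + 1) → ℝ), (∀ i, a i ∈ valueGroup v) →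
      (a ∈ tropicalDoubleRootSpace v n ↔
        MinAttainedTwice {i : Fin (n + 1) | Even (i : ℕ)} a ∧
          MinAttainedTwice {i : Fin (n + 1) | Odd (i : ℕ)} a)) ∧
    (∀ n : ℕ, 2 ≤ n →
      ∃ Φ : Set (PointedCone ℝ (Fin (2 * n - 1 + 1) → ℝ)),
        IsCoarsestFan Φ (closure (tropicalDoubleRootSpace v (2 * n - 1))) ∧
          {σ | Maximal (fun τ => τ ∈ Φ) σ}.ncard = (n.choose 2) ^ 2) := by
  refine ⟨fun n a ha => mem_tropicalDoubleRootSpace_iff v ha, fun n hn => ?_⟩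
  refine ⟨minFan fun i : Fin (2 * n - 1 + 1) => decide (Even (i : ℕ)), ?_, ?_⟩
  · rw [closure_tropicalDoubleRootSpace v hv]
    exact isCoarsestFan_minFan _
  · rw [ncard_setOf_maximal_minFan]
    have h : 2 * n - 1 + 1 = 2 * n := by omega
    rw [h]
    simp only [card_filter_even_eq, Finset.prod_const, Finset.card_univ, Fintype.card_bool]
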